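/- An $FL_{ew}$-algebra is a structure $\langle A;\wedge,\vee,\cdot,\to,0,1\rangle$ such that $\langle A;\wedge,\vee,0,1\rangle$ is a bounded lattice, $\langle A;\cdot,1\rangle$ is a commutative monoid, and $a\cdot b\le c$ if and only if $a\le b\to c$. It is weakly-archimedean if $a\le b^n$ for all $n\in\mathbb N$ implies $ab=a$, and $n$-contractive if $a^{n+1}=a^n$ for all $a$. Let $\mathcal A$ be a class of linearly ordered weakly-archimedean $FL_{ew}$-algebras such that for every $n\in\mathbb N$ some algebra in $\mathcal A$ is not $n$-contractive. Consider modal formulas over a countably infinite set of variables in the language $\wedge,\vee,\cdot,\to,0,1,\Box,\Diamond,\Delta$. An $\mathcal A$-model $\langle W,R,e\rangle$ consists of a non-empty set $W$, a binary relation $R$ on $W$, and an assignment $e$ of values in some $A\in\mathcal A$ to each variable at each world. The assignment is extended to all formulas world-wise by the operations of $A$, by $e(w,\Delta\varphi)=1$ if $e(w,\varphi)=1$ and $e(w,\Delta\varphi)=0$ otherwise, and by $e(w,\Box\varphi)=\bigwedge_{Rwx}e(x,\varphi)$ and $e(w,\Diamond\varphi)=\bigvee_{Rwx}e(x,\varphi)$;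 the model is required to be safe, i.e. all these infima and suprema exist. A model is transitive if $R$ is, and finite if $W$ is. A formula $\varphi$ is valid in a class of models if $e(w,\varphi)=1$ for every world $w$ of every model in the class, and locally satisfiable in the class if $e(w,\varphi)=1$ for some world $w$ of some model in the class. Then: 1. The set of formulas valid in all transitive $\mathcal A$-models is undecidable, and so is the set of formulas valid in all finite transitive $\mathcal A$-models. 2. If moreover no algebra in $\mathcal A$ is trivial (that is, $0\neq 1$ in each of them), then the set of formulas locally satisfiable in the class of transitive $\mathcal A$-models is undecidable, and so is the set of formulas locally satisfiable in the class of finite transitive $\mathcal A$-models. -/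

import Mathlib

universe u v

namespace ModalFLew

/-! ### Algebras -/

/-- `FL_ew`-algebras: bounded lattices with a commutative monoid whose unit is the top element and
whose product is residuated. The constant `0` is the bottom element `⊥`. -/
class FLewAlgebra (A : Type u) extends Lattice A, BoundedOrder A, CommMonoid A where
  /-- the residuum `a → b` -/
  imp : A → A → A
  one_eq_top : (1 : A) = ⊤
  mul_le_iff_le_imp : ∀ a b c : A, a * b ≤ c ↔ a ≤ imp b c

/-- A bundled `FL_ew`-algebra, so that one can speak about classes of them. -/
structure FLewAlg where
  carrier : Type u
  [str : FLewAlgebra carrier]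

instance : CoeSort FLewAlg.{u} (Type u) := ⟨FLewAlg.carrier⟩

instance (A : FLewAlg.{u}) : FLewAlgebra A := A.str

/-- The lattice order of the algebra is linear. -/
def FLewAlg.IsChain (A : FLewAlg.{u}) : Prop :=
  ∀ a b : A, a ≤ b ∨ b ≤ a

/-- `A` is `n`-contractive. -/
def FLewAlg.IsContractive (A : FLewAlg.{u}) (n : ℕ) : Prop :=
  ∀ a : A, a ^ (n + 1) = a ^ n

/-- `A` is weakly-archimedean. -/
def FLewAlg.IsWeaklyArchimedean (A : FLewAlg.{u}) : Prop :=
  ∀ a b : A, (∀ n : ℕ, a ≤ b ^ n) → a * b = a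

open Classical in
/-- The Monteiro–Baaz operation. -/
noncomputable def baazDelta {A : Type u} [FLewAlgebra A] (a : A) : A :=
  if a = 1 then 1 else ⊥

/-! ### Modal formulas with `Δ` -/

/-- Modal formulas over the variables `p₀, p₁, …` in the language
`∧, ∨, ·, →, 0, 1, □, ◇, Δ`. -/
inductive Formula : Type where
  | zero : Formula
  | one : Formula
  | var : ℕ → Formula
  | box : Formula → Formula
  | dia : Formula → Formula
  | delta : Formula → Formula
  | and : Formula → Formula → Formula
  | or : Formula → Formula → Formula
  | mul : Formula → Formula → Formula
  | imp : Formula → Formula → Formula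

namespace Formula

/-- The Gödel number of a formula. -/
def toNat : Formula → ℕ
  | zero => 0
  | one => 1
  | var n => 8 * n + 2
  | box φ => 8 * φ.toNat + 3
  | dia φ => 8 * φ.toNat + 4
  | delta φ => 8 * φ.toNat + 5
  | and φ ψ => 8 * Nat.pair φ.toNat ψ.toNat + 6
  | or φ ψ => 8 * Nat.pair φ.toNat ψ.toNat + 7
  | mul φ ψ => 8 * Nat.pair φ.toNat ψ.toNat + 8
  | imp φ ψ => 8 * Nat.pair φ.toNat ψ.toNat + 9

/-- The formula with a given Gödel number. -/
def ofNat : ℕ → Formula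
  | 0 => zero
  | 1 => one
  | n + 2 =>
    have h : n / 8 < n + 2 := by omega
    have h₁ : (n / 8).unpair.1 < n + 2 := lt_of_le_of_lt (Nat.unpair_left_le _) h
    have h₂ : (n / 8).unpair.2 < n + 2 := lt_of_le_of_lt (Nat.unpair_right_le _) h
    match n % 8 with
    | 0 => var (n / 8)
    | 1 => box (ofNat (n / 8))
    | 2 => dia (ofNat (n / 8))
    | 3 => delta (ofNat (n / 8))
    | 4 => and (ofNat (n / 8).unpair.1) (ofNat (n / 8).unpair.2)
    | 5 => or (ofNat (n / 8).unpair.1) (ofNat (n / 8).unpair.2)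
    | 6 => mul (ofNat (n / 8).unpair.1) (ofNat (n / 8).unpair.2)
    | _ => imp (ofNat (n / 8).unpair.1) (ofNat (n / 8).unpair.2)

theorem ofNat_toNat (φ : Formula) : ofNat φ.toNat = φ := by
  induction φ with
  | zero => simp [toNat, ofNat]
  | one => simp [toNat, ofNat]
  | var n =>
    have h1 : 8 * n / 8 = n := by omega
    have h2 : 8 * n % 8 = 0 := by omega
    simp [toNat, ofNat, h1, h2]
  | box φ ih =>
    have h1 : (8 * φ.toNat + 1) / 8 = φ.toNat := by omega
    have h2 : (8 * φ.toNat + 1) % 8 = 1 := by omega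
    simp [toNat, ofNat, h1, h2, ih]
  | dia φ ih =>
    have h1 : (8 * φ.toNat + 2) / 8 = φ.toNat := by omega
    have h2 : (8 * φ.toNat + 2) % 8 = 2 := by omega
    simp [toNat, ofNat, h1, h2, ih]
  | delta φ ih =>
    have h1 : (8 * φ.toNat + 3) / 8 = φ.toNat := by omega
    have h2 : (8 * φ.toNat + 3) % 8 = 3 := by omega
    simp [toNat, ofNat, h1, h2, ih]
  | and φ ψ ih₁ ih₂ =>
    have h1 : (8 * Nat.pair φ.toNat ψ.toNat + 4) / 8 = Nat.pair φ.toNat ψ.toNat := by omega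
    have h2 : (8 * Nat.pair φ.toNat ψ.toNat + 4) % 8 = 4 := by omega
    simp [toNat, ofNat, h1, h2, ih₁, ih₂]
  | or φ ψ ih₁ ih₂ =>
    have h1 : (8 * Nat.pair φ.toNat ψ.toNat + 5) / 8 = Nat.pair φ.toNat ψ.toNat := by omega
    have h2 : (8 * Nat.pair φ.toNat ψ.toNat + 5) % 8 = 5 := by omega
    simp [toNat, ofNat, h1, h2, ih₁, ih₂]
  | mul φ ψ ih₁ ih₂ =>
    have h1 : (8 * Nat.pair φ.toNat ψ.toNat + 6) / 8 = Nat.pair φ.toNat ψ.toNat := by omega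
    have h2 : (8 * Nat.pair φ.toNat ψ.toNat + 6) % 8 = 6 := by omega
    simp [toNat, ofNat, h1, h2, ih₁, ih₂]
  | imp φ ψ ih₁ ih₂ =>
    have h1 : (8 * Nat.pair φ.toNat ψ.toNat + 7) / 8 = Nat.pair φ.toNat ψ.toNat := by omega
    have h2 : (8 * Nat.pair φ.toNat ψ.toNat + 7) % 8 = 7 := by omega
    simp [toNat, ofNat, h1, h2, ih₁, ih₂]

theorem toNat_ofNat (n : ℕ) : (ofNat n).toNat = n := by
  induction n using Nat.strong_induction_on with
  | _ n ih =>
    match n, ih with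
    | 0, _ => simp [toNat, ofNat]
    | 1, _ => simp [toNat, ofNat]
    | n + 2, ih =>
      have h : n / 8 < n + 2 := by omega
      have h₀ := ih _ h
      have h₁ := ih _ (lt_of_le_of_lt (Nat.unpair_left_le (n / 8)) h)
      have h₂ := ih _ (lt_of_le_of_lt (Nat.unpair_right_le (n / 8)) h)
      rw [ofNat]
      have hn : n % 8 = 0 ∨ n % 8 = 1 ∨ n % 8 = 2 ∨ n % 8 = 3 ∨ n % 8 = 4 ∨ n % 8 = 5 ∨
          n % 8 = 6 ∨ n % 8 = 7 := by omega
      rcases hn with hn | hn | hn | hn | hn | hn | hn | hn <;>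
        simp only [hn, toNat, h₀, h₁, h₂, Nat.pair_unpair] <;> omega

/-- The (bijective) Gödel numbering of formulas. -/
def equivNat : Formula ≃ ℕ := ⟨toNat, ofNat, ofNat_toNat, toNat_ofNat⟩

/-- Computability of predicates on formulas is computability on Gödel numbers. -/
instance : Primcodable Formula := Primcodable.ofEquiv ℕ equivNat

end Formula

/-! ### Kripke models -/

/-- A Kripke model over some `FL_ew`-algebra: a non-empty set of worlds with a crisp accessibility
relation, and a value in the algebra for each variable at each world. -/
structure KripkeModel : Type (max (u + 1) (v + 1)) where
  alg : FLewAlg.{u}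
  World : Type v
  [nonempty : Nonempty World]
  R : World → World → Prop
  val : ℕ → World → alg

namespace KripkeModel

open Classical in
/-- The value `e(w, φ)`. The values of `□` and `◇` are the infimum and the supremum over all
successors; when these do not exist, an arbitrary value is used, and safe models (below) are exactly
those in which this never happens. -/
noncomputable def eval (M : KripkeModel.{u, v}) : Formula → M.World → M.alg
  | .zero, _ => ⊥
  | .one, _ => 1
  | .var n, w => M.val n w
  | .box φ, w =>
    if h : ∃ a, IsGLB {b | ∃ x, M.R w x ∧ b = M.eval φ x} a then h.choose else ⊥
  | .dia φ, w =>
    if h : ∃ a, IsLUB {b | ∃ x, M.R w x ∧ b = M.eval φ x} a then h.choose else ⊥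
  | .delta φ, w => baazDelta (M.eval φ w)
  | .and φ ψ, w => M.eval φ w ⊓ M.eval ψ w
  | .or φ ψ, w => M.eval φ w ⊔ M.eval ψ w
  | .mul φ ψ, w => M.eval φ w * M.eval ψ w
  | .imp φ ψ, w => FLewAlgebra.imp (M.eval φ w) (M.eval ψ w)

/-- A model is safe when the values of `□φ` and `◇φ` are defined for all formulas `φ` (of the
language with `Δ`) at all worlds. -/
def Safe (M : KripkeModel.{u, v}) : Prop :=
  ∀ (φ : Formula) (w : M.World),
    (∃ a, IsGLB {b | ∃ x, M.R w x ∧ b = M.eval φ x} a) ∧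
    (∃ a, IsLUB {b | ∃ x, M.R w x ∧ b = M.eval φ x} a)

/-- `M, w ⊨ φ`. -/
def Sat (M : KripkeModel.{u, v}) (w : M.World) (φ : Formula) : Prop :=
  M.eval φ w = 1

end KripkeModel

/-- The class `K_𝒜` of safe Kripke models over the algebras in `𝒜`. -/
def safeModels (𝒜 : Set FLewAlg.{u}) : Set KripkeModel.{u, v} :=
  {M | M.alg ∈ 𝒜 ∧ M.Safe}

/-- The class `4K_𝒜` of transitive models in `K_𝒜`. -/
def transModels (𝒜 : Set FLewAlg.{u}) : Set KripkeModel.{u, v} :=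
  {M | M ∈ safeModels 𝒜 ∧ ∀ x y z : M.World, M.R x y → M.R y z → M.R x z}

/-- The class `ω4K_𝒜` of models in `4K_𝒜` with finitely many worlds. -/
def finTransModels (𝒜 : Set FLewAlg.{u}) : Set KripkeModel.{u, v} :=
  {M | M ∈ transModels 𝒜 ∧ Finite M.World}

/-- `φ` follows locally from the finite set `Γ` in the class `C`. -/
def LocallyFollows (C : Set KripkeModel.{u, v}) (Γ : Finset Formula) (φ : Formula) : Prop :=
  ∀ M ∈ C, ∀ w : M.World, (∀ γ ∈ Γ, M.Sat w γ) → M.Sat w φ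

/-- `φ` is a valid formula of the local logic of `C`. -/
def Valid (C : Set KripkeModel.{u, v}) (φ : Formula) : Prop :=
  LocallyFollows C ∅ φ

/-- `φ` is locally satisfiable in `C`: it has value `1` at some world of some model in `C`. -/
def LocallySatisfiable (C : Set KripkeModel.{u, v}) (φ : Formula) : Prop :=
  ∃ M ∈ C, ∃ w : M.World, M.Sat w φ

end ModalFLew

/-!
The halting problem reduces to satisfiability: for a fixed counter machine, a formula that depends
computably on the input `n` is satisfied in a transitive model over a nontrivial algebra exactly if
the machine halts on `n`, and in that case also in a finite one.

*Numbers.* Three variables are constant in the model: `a`, a lower bound `z` with `z * a ≠ z`, and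
`a ^ n`. A number `k` is represented by `a ^ k`, and all values in use are required to be at least
`z`. By weak archimedeanity some power of `a` is not above `z`, and the powers of `a` above `z` are
pairwise distinct (`FLewAlgebra.pow_inj_of_le`). Conversely, an algebra that is not `K`-contractive
has room for the numbers up to `K`, with `z = a ^ K`.

*Time.* A transitive relation has no next-time operator, so time runs from the worlds without
successors towards the root. A time variable `T` satisfies `T = a` at worlds without successors and
`T = a * □T` elsewhere, so that a world of height `t` has `T = a ^ (t + 1)`; as `T ≥ z`, the heights
are bounded. Along the run the powers that represent a number that never decreases form a
decreasing sequence, hence `□` returns the value at the latest time among the successors, which is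
one time unit earlier. Each register is therefore stored as a difference of two counters that never
decrease. A two-valued `ψ` holds one time unit earlier exactly if `□(Δψ → T) ≤ □T`
(`KripkeModel.Past.sat_prevLabel`). By `KripkeModel.sat_transition` and induction on the height,
the root and every world below it describe the configuration at the time given by their height,
because the machine is deterministic (`KripkeModel.exists_run_of_sat`). A halting run gives a finite
chain as a model (`KripkeModel.exists_model_of_run`).

*Machines.* The machines add and subtract registers and test for zero. Primitive recursive functions
are computed by while programs (`Prog.computes_of_primrec'`), which compile to machines
(`Prog.Run.leads`). Since the halting set is the projection of a primitive recursive relation, one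
further loop gives a machine with undecidable halting problem (`exists_undecidable_prog`).

Satisfiability over nontrivial algebras is dual to validity: `Δφ → 0` is valid exactly if no model
over a nontrivial algebra satisfies `φ` at a world.
-/

namespace ModalFLew

/-! ### Counter machines with monotone counters -/

/-- Instructions of a register machine over `ℤ`: add or subtract a register, or branch on whether a
register vanishes. -/
inductive Instr : Type where
  | add (r s : ℕ) : Instr
  | sub (r s : ℕ) : Instr
  | test (r l l' : ℕ) : Instr

/-- A configuration whose register `r` is stored as the difference `cnt r true - cnt r false` of two
counters that never decrease during a run. -/
structure Cfg : Type where
  pc : ℕ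
  cnt : ℕ → Bool → ℕ

namespace Instr

/-- The counter, if any, that an instruction adds to the counter `(r', b)`. -/
def source : Instr → ℕ → Bool → Option (ℕ × Bool)
  | add r s, r', b => if r' = r then some (s, b) else none
  | sub r s, r', b => if r' = r then some (s, !b) else none
  | test _ _ _, _, _ => none

/-- The counters after executing an instruction. -/
def update (ins : Instr) (c : ℕ → Bool → ℕ) (r : ℕ) (b : Bool) : ℕ :=
  c r b + ((ins.source r b).elim 0 fun p => c p.1 p.2)

/-- The label reached from label `i`. -/
def next : Instr → ℕ → (ℕ → Bool → ℕ) → ℕ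
  | add _ _, i, _ => i + 1
  | sub _ _, i, _ => i + 1
  | test r l l', _, c => if c r true = c r false then l else l'

/-- All registers of the instruction at label `i`, and all labels reached from it, are below `m`. -/
def Within (m i : ℕ) : Instr → Prop
  | add r s => r < m ∧ s < m ∧ i + 1 < m
  | sub r s => r < m ∧ s < m ∧ i + 1 < m
  | test r l l' => r < m ∧ l < m ∧ l' < m

theorem Within.source_lt {m i : ℕ} {ins : Instr} (h : ins.Within m i) {r : ℕ} {b : Bool}
    {p : ℕ × Bool} (hp : ins.source r b = some p) : p.1 < m := by
  cases ins with
  | add r' s =>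
    simp only [source] at hp
    split_ifs at hp
    cases hp
    exact h.2.1
  | sub r' s =>
    simp only [source] at hp
    split_ifs at hp
    cases hp
    exact h.2.1
  | test r' l l' => simp [source] at hp

theorem Within.next_lt {m i : ℕ} {ins : Instr} (h : ins.Within m i) (c : ℕ → Bool → ℕ) :
    ins.next i c < m := by
  cases ins with
  | add r s => exact h.2.2
  | sub r s => exact h.2.2
  | test r l l' =>
    simp only [next]
    split_ifs
    exacts [h.2.1, h.2.2]

end Instr

namespace Cfg

/-- One step of the machine. The branch is decided by the updated counters, which for a `test`
instruction are the old ones. -/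
def step (prog : ℕ → Instr) (c : Cfg) : Cfg where
  pc := (prog c.pc).next c.pc ((prog c.pc).update c.cnt)
  cnt := (prog c.pc).update c.cnt

/-- The initial configuration: register `0` holds `1`, register `1` holds the input. -/
def init (n : ℕ) : Cfg where
  pc := 0
  cnt r b := if b = true then (if r = 0 then 1 else if r = 1 then n else 0) else 0

/-- The configuration at time `t` on input `n`. -/
def run (prog : ℕ → Instr) (n t : ℕ) : Cfg :=
  (step prog)^[t] (init n)

theorem run_succ (prog : ℕ → Instr) (n t : ℕ) : run prog n (t + 1) = step prog (run prog n t) :=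
  Function.iterate_succ_apply' _ _ _

theorem monotone_run_cnt (prog : ℕ → Instr) (n r : ℕ) (b : Bool) :
    Monotone fun t => (run prog n t).cnt r b :=
  monotone_nat_of_le_succ fun t => by
    simp only [run_succ, step, Instr.update]
    exact Nat.le_add_right _ _

theorem run_pc_lt {prog : ℕ → Instr} {m : ℕ} (hm : ∀ i, (prog i).Within m i) (n t : ℕ) :
    (run prog n t).pc < m := by
  cases t with
  | zero => exact Nat.zero_lt_of_lt ((hm 0).next_lt (init n).cnt)
  | succ t =>
    rw [run_succ]
    exact (hm _).next_lt _

end Cfg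

/-! ### Arithmetic of powers in `FL_ew`-algebras -/

namespace FLewAlgebra

variable {A : Type u} [FLewAlgebra A]

theorem le_one' (a : A) : a ≤ 1 := by
  rw [one_eq_top]
  exact le_top

theorem imp_eq_one_iff {a b : A} : imp a b = 1 ↔ a ≤ b := by
  rw [← one_mul a, mul_le_iff_le_imp, one_mul]
  exact ⟨fun h => h.ge, fun h => le_antisymm (le_one' _) h⟩

theorem one_imp (a : A) : imp 1 a = a := by
  apply le_antisymm
  · have := (mul_le_iff_le_imp (imp 1 a) 1 a).2 le_rfl
    rwa [mul_one] at this
  · rw [← mul_le_iff_le_imp, mul_one]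

theorem mul_mono_right {a b : A} (c : A) (h : a ≤ b) : c * a ≤ c * b := by
  rw [mul_comm c a, mul_le_iff_le_imp]
  refine h.trans ?_
  rw [← mul_le_iff_le_imp, mul_comm]

theorem mul_le_left' (a b : A) : a * b ≤ a :=
  (mul_mono_right a (le_one' b)).trans_eq (mul_one a)

theorem pow_anti (a : A) {m n : ℕ} (h : m ≤ n) : a ^ n ≤ a ^ m := by
  obtain ⟨k, rfl⟩ := Nat.exists_eq_add_of_le h
  rw [pow_add]
  exact mul_le_left' _ _

/-- If the powers of `a` are stationary at some place above `z`, then `a` does not strictly decrease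
`z`; here weak archimedeanity enters. -/
theorem pow_succ_ne_of_le (harch : ∀ a b : A, (∀ n : ℕ, a ≤ b ^ n) → a * b = a) {a z : A}
    (hz : z * a ≠ z) {n : ℕ} (hn : z ≤ a ^ n) : a ^ (n + 1) ≠ a ^ n := by
  intro h
  refine hz (harch z a fun k => ?_)
  have hk : ∀ k, a ^ (n + k) = a ^ n := by
    intro k
    induction k with
    | zero => rfl
    | succ k ih => rw [← add_assoc, pow_succ, ih, ← pow_succ, h]
  calc z ≤ a ^ n := hn
    _ = a ^ (n + k) := (hk k).symm
    _ ≤ a ^ k := pow_anti a (Nat.le_add_left k n)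

/-- The powers of `a` above `z` are pairwise distinct. -/
theorem pow_inj_of_le (harch : ∀ a b : A, (∀ n : ℕ, a ≤ b ^ n) → a * b = a) {a z : A}
    (hz : z * a ≠ z) {m n : ℕ} (hm : z ≤ a ^ m) (hn : z ≤ a ^ n) (h : a ^ m = a ^ n) : m = n := by
  have key : ∀ {m n : ℕ}, z ≤ a ^ m → a ^ m = a ^ n → ¬ m < n := by
    intro m n hm h hlt
    refine pow_succ_ne_of_le harch hz hm (le_antisymm (pow_anti a (Nat.le_succ m)) ?_)
    rw [h]
    exact pow_anti a hlt
  have h1 := key hm h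
  have h2 := key hn h.symm
  omega

end FLewAlgebra

/-! ### Satisfaction in safe models -/

namespace Formula

/-- Equivalence. -/
def iff (φ ψ : Formula) : Formula := and (imp φ ψ) (imp ψ φ)

/-- The two-valued implication: `φ` has value `1` only if `ψ` has. -/
def crispImp (φ ψ : Formula) : Formula := imp (delta φ) ψ

/-- The two-valued negation: `φ` does not have value `1`. -/
def crispNot (φ : Formula) : Formula := crispImp φ zero

/-- Finite conjunctions. -/
def conj (l : List Formula) : Formula := l.foldr and one

/-- The conjunction of the formulas `f i` with `i < m`. -/
def all (m : ℕ) (f : ℕ → Formula) : Formula := conj ((List.range m).map f)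

/-- The conjunction of `f false` and `f true`. -/
def allBool (f : Bool → Formula) : Formula := and (f false) (f true)

/-- Powers with respect to the product. -/
def pow (φ : Formula) : ℕ → Formula
  | 0 => one
  | n + 1 => mul φ (pow φ n)

end Formula

namespace KripkeModel

open Formula FLewAlgebra

variable {M : KripkeModel.{u, v}} {w : M.World} {φ ψ : Formula}

theorem sat_and : M.Sat w (and φ ψ) ↔ M.Sat w φ ∧ M.Sat w ψ := by
  simp only [Sat, eval]
  rw [one_eq_top]
  exact inf_eq_top_iff

theorem sat_imp : M.Sat w (imp φ ψ) ↔ M.eval φ w ≤ M.eval ψ w := by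
  simp only [Sat, eval]
  exact imp_eq_one_iff

theorem sat_iff : M.Sat w (iff φ ψ) ↔ M.eval φ w = M.eval ψ w := by
  rw [iff, sat_and, sat_imp, sat_imp]
  exact ⟨fun h => le_antisymm h.1 h.2, fun h => ⟨h.le, h.ge⟩⟩

theorem eval_delta_of_sat (h : M.Sat w φ) : M.eval (delta φ) w = 1 := by
  simp only [eval, baazDelta]
  exact if_pos h

theorem eval_delta_of_not_sat (h : ¬ M.Sat w φ) : M.eval (delta φ) w = ⊥ := by
  simp only [eval, baazDelta]
  exact if_neg h

theorem eval_crispImp_of_sat (h : M.Sat w φ) : M.eval (crispImp φ ψ) w = M.eval ψ w := by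
  rw [crispImp, eval, eval_delta_of_sat h, one_imp]

theorem eval_crispImp_of_not_sat (h : ¬ M.Sat w φ) : M.eval (crispImp φ ψ) w = 1 := by
  rw [crispImp, eval, eval_delta_of_not_sat h]
  exact imp_eq_one_iff.2 bot_le

theorem sat_crispImp : M.Sat w (crispImp φ ψ) ↔ (M.Sat w φ → M.Sat w ψ) := by
  by_cases h : M.Sat w φ
  · simp only [h, true_imp_iff]
    rw [Sat, eval_crispImp_of_sat h]
    rfl
  · simp only [h, false_imp_iff, iff_true]
    exact eval_crispImp_of_not_sat h

theorem sat_one : M.Sat w one := rfl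

theorem not_sat_zero [Nontrivial M.alg] : ¬ M.Sat w zero := by
  simp only [Sat, eval]
  rw [one_eq_top]
  exact bot_ne_top

theorem sat_crispNot [Nontrivial M.alg] : M.Sat w (crispNot φ) ↔ ¬ M.Sat w φ := by
  rw [crispNot, sat_crispImp]
  exact ⟨fun h h' => not_sat_zero (h h'), fun h h' => (h h').elim⟩

theorem sat_conj {l : List Formula} : M.Sat w (conj l) ↔ ∀ φ ∈ l, M.Sat w φ := by
  induction l with
  | nil => simpa [conj] using sat_one
  | cons φ l ih => simpa [conj, sat_and] using fun _ => ih

theorem sat_all {m : ℕ} {f : ℕ → Formula} : M.Sat w (all m f) ↔ ∀ i < m, M.Sat w (f i) := by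
  simp [all, sat_conj]

theorem sat_allBool {f : Bool → Formula} : M.Sat w (allBool f) ↔ ∀ b, M.Sat w (f b) := by
  simp [allBool, sat_and]

theorem eval_pow (n : ℕ) : M.eval (pow φ n) w = M.eval φ w ^ n := by
  induction n with
  | zero => simp [pow, eval]
  | succ n ih => rw [pow, eval, ih, pow_succ']

theorem Safe.isGLB (hM : M.Safe) (φ : Formula) (w : M.World) :
    IsGLB {b | ∃ x, M.R w x ∧ b = M.eval φ x} (M.eval (box φ) w) := by
  rw [eval, dif_pos (hM φ w).1]
  exact (hM φ w).1.choose_spec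

theorem Safe.isLUB (hM : M.Safe) (φ : Formula) (w : M.World) :
    IsLUB {b | ∃ x, M.R w x ∧ b = M.eval φ x} (M.eval (dia φ) w) := by
  rw [eval, dif_pos (hM φ w).2]
  exact (hM φ w).2.choose_spec

theorem Safe.box_le (hM : M.Safe) (φ : Formula) {w x : M.World} (h : M.R w x) :
    M.eval (box φ) w ≤ M.eval φ x :=
  (hM.isGLB φ w).1 ⟨x, h, rfl⟩

theorem Safe.le_box (hM : M.Safe) {a : M.alg} (h : ∀ x, M.R w x → a ≤ M.eval φ x) :
    a ≤ M.eval (box φ) w :=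
  (hM.isGLB φ w).2 fun b hb => by
    obtain ⟨x, hx, rfl⟩ := hb
    exact h x hx

theorem Safe.box_eq (hM : M.Safe) {x₀ : M.World} (h₀ : M.R w x₀)
    (h : ∀ x, M.R w x → M.eval φ x₀ ≤ M.eval φ x) : M.eval (box φ) w = M.eval φ x₀ :=
  le_antisymm (hM.box_le φ h₀) (hM.le_box h)

theorem Safe.sat_box (hM : M.Safe) : M.Sat w (box φ) ↔ ∀ x, M.R w x → M.Sat x φ := by
  constructor
  · intro h x hx
    have := hM.box_le φ hx
    rw [h] at this
    exact le_antisymm (le_one' _) this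
  · intro h
    exact le_antisymm (le_one' _) (hM.le_box fun x hx => (h x hx).ge)

theorem Safe.sat_box_zero [Nontrivial M.alg] (hM : M.Safe) :
    M.Sat w (box zero) ↔ ∀ x, ¬ M.R w x := by
  rw [hM.sat_box]
  exact ⟨fun h x hx => not_sat_zero (h x hx), fun h x hx => (h x hx).elim⟩

/-- `φ` has at all successors the value that it has at `w`. -/
theorem Safe.sat_const (hM : M.Safe) :
    M.Sat w (and (imp φ (box φ)) (imp (dia φ) φ)) ↔ ∀ x, M.R w x → M.eval φ x = M.eval φ w := by
  rw [sat_and, sat_imp, sat_imp]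
  constructor
  · rintro ⟨h1, h2⟩ x hx
    exact le_antisymm (((hM.isLUB φ w).1 ⟨x, hx, rfl⟩).trans h2) (h1.trans (hM.box_le φ hx))
  · intro h
    refine ⟨hM.le_box fun x hx => (h x hx).ge, (hM.isLUB φ w).2 ?_⟩
    rintro b ⟨x, hx, rfl⟩
    exact (h x hx).le

end KripkeModel

/-! ### Machine runs as modal formulas -/

namespace Formula

/-- The base `a` of the powers that represent numbers; constant in a model. -/
def base : Formula := var 0

/-- A lower bound for all powers in use; constant in a model. -/
def floor : Formula := var 1

/-- The power of `a` that represents the input; constant in a model. -/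
def input : Formula := var 2

/-- At time `t` this variable has the value `a ^ (t + 1)`. -/
def time : Formula := var 3

/-- The power of `a` that represents the counter `(r, b)`. -/
def cnt (r : ℕ) (b : Bool) : Formula := if b = true then var (3 * r + 4) else var (3 * r + 5)

/-- This variable has the value `1` exactly if the machine is at label `i`. -/
def atLabel (i : ℕ) : Formula := var (3 * i + 6)

/-- The machine is at label `j`, and at no other label below `m`. -/
def state (m j : ℕ) : Formula := all m fun i => if i = j then atLabel i else crispNot (atLabel i)

/-- The machine was at label `i` one time unit earlier: among the successors at label `i` is one
whose time is as late as that of any successor. -/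
def prevLabel (i : ℕ) : Formula := imp (box (crispImp (atLabel i) time)) (box time)

/-- The initial value of the counter `(r, b)`. -/
def initCnt (r : ℕ) (b : Bool) : Formula :=
  if b = true then (if r = 0 then base else if r = 1 then input else one) else one

/-- The value of the counter `(r, b)` after executing `ins`. As counters never decrease in time,
`□` gives their values one time unit earlier. -/
def newCnt (ins : Instr) (r : ℕ) (b : Bool) : Formula :=
  (ins.source r b).elim (box (cnt r b)) fun p => mul (box (cnt r b)) (box (cnt p.1 p.2))

/-- The label after executing the instruction `ins` at label `i`. -/
def stateAfter (m i : ℕ) : Instr → Formula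
  | .add _ _ => state m (i + 1)
  | .sub _ _ => state m (i + 1)
  | .test r l l' =>
    and (crispImp (iff (cnt r true) (cnt r false)) (state m l))
      (crispImp (crispNot (iff (cnt r true) (cnt r false))) (state m l'))

/-- All values in use are above the lower bound. -/
def aboveFloor (m : ℕ) : Formula :=
  and (imp floor time) (all m fun r => allBool fun b => imp floor (cnt r b))

/-- Worlds without successors describe the initial configuration. -/
def initial (m : ℕ) : Formula :=
  and (iff time base)
    (and (all m fun r => allBool fun b => iff (cnt r b) (initCnt r b)) (state m 0))

/-- The configuration at a world results from the latest one at its successors. -/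
def transition (prog : ℕ → Instr) (m : ℕ) : Formula :=
  and (iff time (mul base (box time)))
    (all m fun i => crispImp (prevLabel i)
      (and (all m fun r => allBool fun b => iff (cnt r b) (newCnt (prog i) r b))
        (stateAfter m i (prog i))))

/-- The conditions imposed on every world. -/
def describesRun (prog : ℕ → Instr) (m : ℕ) : Formula :=
  and (aboveFloor m)
    (and (crispImp (box zero) (initial m)) (crispImp (crispNot (box zero)) (transition prog m)))

/-- The value of `φ` does not change from a world to its successors. -/
def const (φ : Formula) : Formula := and (imp φ (box φ)) (imp (dia φ) φ)

/-- The part of `reaches` that does not depend on the input. -/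
def reachesAux (prog : ℕ → Instr) (m l : ℕ) : Formula :=
  and (and (const base) (and (const floor) (const input)))
    (and (crispNot (imp floor (mul floor base)))
      (and (atLabel l) (and (describesRun prog m) (box (describesRun prog m)))))

/-- The machine reaches the label `l` from the input `n`. -/
def reaches (prog : ℕ → Instr) (m l n : ℕ) : Formula :=
  and (reachesAux prog m l) (iff input (pow base n))

end Formula

namespace KripkeModel

open Formula FLewAlgebra

/-- The world `w` describes the configuration `c` at time `t`, with numbers represented by powers of
`a`, as far as registers and labels below `m` are concerned. -/
structure Describes (M : KripkeModel.{u, v}) (m : ℕ) (a : M.alg) (c : Cfg) (t : ℕ)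
    (w : M.World) : Prop where
  time : M.eval time w = a ^ (t + 1)
  cnt : ∀ r < m, ∀ b, M.eval (cnt r b) w = a ^ c.cnt r b
  label : ∀ i < m, M.Sat w (atLabel i) ↔ i = c.pc

variable {M : KripkeModel.{u, v}} {w : M.World} {m : ℕ} {a z : M.alg}

theorem sat_state [Nontrivial M.alg] {j : ℕ} :
    M.Sat w (state m j) ↔ ∀ i < m, M.Sat w (atLabel i) ↔ i = j := by
  rw [state, sat_all]
  refine forall₂_congr fun i _ => ?_
  split_ifs with h
  · simp [h]
  · rw [sat_crispNot]
    simp [h]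

theorem sat_aboveFloor (hz : M.eval floor w = z) :
    M.Sat w (aboveFloor m) ↔
      z ≤ M.eval time w ∧ ∀ r < m, ∀ b, z ≤ M.eval (cnt r b) w := by
  rw [aboveFloor, sat_and, sat_imp, sat_all, hz]
  simp_rw [sat_allBool, sat_imp, hz]

theorem sat_initial [Nontrivial M.alg] {n : ℕ} (ha : M.eval base w = a)
    (hn : M.eval input w = a ^ n) :
    M.Sat w (initial m) ↔ Describes M m a (Cfg.init n) 0 w := by
  have hi : ∀ r b, M.eval (initCnt r b) w = a ^ (Cfg.init n).cnt r b := by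
    intro r b
    simp only [initCnt, Cfg.init]
    split_ifs
    · rw [ha, pow_one]
    · exact hn
    · exact (pow_zero a).symm
    · exact (pow_zero a).symm
  rw [initial, sat_and, sat_iff, sat_and, sat_all, sat_state, ha]
  simp_rw [sat_allBool, sat_iff, hi]
  refine ⟨fun h => ⟨by rw [h.1, zero_add, pow_one], h.2.1, h.2.2⟩, fun h => ⟨?_, h.cnt, h.label⟩⟩
  rw [h.time, zero_add, pow_one]

theorem sat_stateAfter [Nontrivial M.alg] {i : ℕ} {ins : Instr} (hins : ins.Within m i)
    {c : ℕ → Bool → ℕ}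
    (hc : ∀ r < m, ∀ b, M.eval (cnt r b) w = a ^ c r b)
    (hz : ∀ r < m, ∀ b, z ≤ M.eval (cnt r b) w)
    (hinj : ∀ {i j : ℕ}, z ≤ a ^ i → z ≤ a ^ j → a ^ i = a ^ j → i = j) :
    M.Sat w (stateAfter m i ins) ↔ ∀ j < m, M.Sat w (atLabel j) ↔ j = ins.next i c := by
  cases ins with
  | add r s => exact sat_state
  | sub r s => exact sat_state
  | test r l l' =>
    have hr := hins.1
    have heq : M.Sat w (iff (cnt r true) (cnt r false)) ↔ c r true = c r false := by
      rw [sat_iff, hc r hr, hc r hr]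
      exact ⟨hinj (hc r hr true ▸ hz r hr true) (hc r hr false ▸ hz r hr false), fun h => by rw [h]⟩
    rw [stateAfter, sat_and, sat_crispImp, sat_crispImp, sat_crispNot, heq, sat_state, sat_state]
    simp only [Instr.next]
    split_ifs with h <;> simp [h]

/-- The information carried by the successors of `w` about a run whose latest time among them is
`t`. -/
structure Past (M : KripkeModel.{u, v}) (m : ℕ) (a : M.alg) (c : ℕ → Cfg) (t : ℕ)
    (w : M.World) : Prop where
  latest : ∃ x, M.R w x ∧ Describes M m a (c t) t x
  describes : ∀ x, M.R w x → ∃ s ≤ t, Describes M m a (c s) s x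

namespace Past

variable {c : ℕ → Cfg} {t : ℕ}

theorem eval_box_time (h : Past M m a c t w) (hM : M.Safe) :
    M.eval (box Formula.time) w = a ^ (t + 1) := by
  obtain ⟨x, hx, hd⟩ := h.latest
  rw [← hd.time]
  refine hM.box_eq hx fun y hy => ?_
  obtain ⟨s, hs, hd'⟩ := h.describes y hy
  rw [hd.time, hd'.time]
  exact pow_anti a (by omega)

theorem eval_box_cnt (h : Past M m a c t w) (hM : M.Safe)
    (hmono : ∀ r b, Monotone fun t => (c t).cnt r b) {r : ℕ} (hr : r < m) (b : Bool) :
    M.eval (box (Formula.cnt r b)) w = a ^ (c t).cnt r b := by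
  obtain ⟨x, hx, hd⟩ := h.latest
  rw [← hd.cnt r hr b]
  refine hM.box_eq hx fun y hy => ?_
  obtain ⟨s, hs, hd'⟩ := h.describes y hy
  rw [hd.cnt r hr, hd'.cnt r hr]
  exact pow_anti a (hmono r b hs)

theorem sat_prevLabel (h : Past M m a c t w) (hM : M.Safe) (hne : a ^ (t + 1) ≠ a ^ t)
    {i : ℕ} (hi : i < m) : M.Sat w (prevLabel i) ↔ i = (c t).pc := by
  rw [prevLabel, sat_imp, h.eval_box_time hM]
  constructor
  · intro hle
    -- otherwise all successors at label `i` describe earlier times, and the infimum is too large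
    by_contra hpc
    refine hne (le_antisymm (pow_anti a (Nat.le_succ t)) (le_trans (hM.le_box fun x hx => ?_) hle))
    obtain ⟨s, hs, hd⟩ := h.describes x hx
    by_cases hx' : M.Sat x (atLabel i)
    · rw [eval_crispImp_of_sat hx', hd.time]
      have hst : s ≠ t := by
        rintro rfl
        exact hpc ((hd.label i hi).1 hx')
      exact pow_anti a (by omega)
    · rw [eval_crispImp_of_not_sat hx']
      exact le_one' _
  · intro hpc
    obtain ⟨x, hx, hd⟩ := h.latest
    refine (hM.box_le _ hx).trans ?_
    rw [eval_crispImp_of_sat ((hd.label i hi).2 hpc), hd.time]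

end Past

/-- A world with successors satisfies the transition conditions if and only if it describes the
configuration that follows the latest one described by its successors. -/
theorem sat_transition [Nontrivial M.alg] {prog : ℕ → Instr}
    (hm : ∀ i, (prog i).Within m i) {n t : ℕ} (hM : M.Safe) (h : Past M m a (Cfg.run prog n) t w)
    (hne : a ^ (t + 1) ≠ a ^ t) (ha : M.eval base w = a)
    (hz : ∀ r < m, ∀ b, z ≤ M.eval (cnt r b) w)
    (hinj : ∀ {i j : ℕ}, z ≤ a ^ i → z ≤ a ^ j → a ^ i = a ^ j → i = j) :
    M.Sat w (transition prog m) ↔ Describes M m a (Cfg.run prog n (t + 1)) (t + 1) w := by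
  set c := Cfg.run prog n t with hc
  have hpc : c.pc < m := Cfg.run_pc_lt hm n t
  have hbox : ∀ r < m, ∀ b, M.eval (box (cnt r b)) w = a ^ c.cnt r b :=
    fun r hr b => h.eval_box_cnt hM (fun r b => Cfg.monotone_run_cnt prog n r b) hr b
  have hnew : ∀ r < m, ∀ b,
      M.eval (newCnt (prog c.pc) r b) w = a ^ (prog c.pc).update c.cnt r b := by
    intro r hr b
    rw [newCnt, Instr.update]
    cases hs : (prog c.pc).source r b with
    | none => simpa using hbox r hr b
    | some p =>
      have hp := (hm c.pc).source_lt hs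
      simp only [Option.elim, eval, pow_add]
      have h1 := hbox r hr b
      have h2 := hbox p.1 hp p.2
      simp only [eval] at h1 h2
      rw [h1, h2]
  have htime : M.eval (mul base (box time)) w = a ^ (t + 1 + 1) := by
    have h1 := h.eval_box_time hM
    simp only [eval] at h1 ha ⊢
    rw [h1]
    simp only [base, eval] at ha ⊢
    rw [ha, ← pow_succ']
  have hall : M.Sat w (transition prog m) ↔ M.eval time w = a ^ (t + 1 + 1) ∧
      (∀ r < m, ∀ b, M.eval (cnt r b) w = a ^ (prog c.pc).update c.cnt r b) ∧
      M.Sat w (stateAfter m c.pc (prog c.pc)) := by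
    rw [transition, sat_and, sat_iff, htime, sat_all]
    refine and_congr_right fun _ => ?_
    have hprev : ∀ i < m, M.Sat w (crispImp (prevLabel i)
        (and (all m fun r => allBool fun b => iff (cnt r b) (newCnt (prog i) r b))
          (stateAfter m i (prog i)))) ↔ (i = c.pc →
        (∀ r < m, ∀ b, M.eval (cnt r b) w = M.eval (newCnt (prog i) r b) w) ∧
          M.Sat w (stateAfter m i (prog i))) := by
      intro i hi
      rw [sat_crispImp, h.sat_prevLabel hM hne hi, sat_and, sat_all]
      simp_rw [sat_allBool, sat_iff]
      exact Iff.rfl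
    rw [forall₂_congr hprev]
    constructor
    · intro H
      have := H c.pc hpc rfl
      exact ⟨fun r hr b => (this.1 r hr b).trans (hnew r hr b), this.2⟩
    · rintro H i _ rfl
      exact ⟨fun r hr b => (H.1 r hr b).trans (hnew r hr b).symm, H.2⟩
  rw [hall, Cfg.run_succ, ← hc]
  constructor
  · rintro ⟨h1, h2, h3⟩
    exact ⟨h1, h2, (sat_stateAfter (hm _) h2 hz hinj).1 h3⟩
  · rintro ⟨h1, h2, h3⟩
    exact ⟨h1, h2, (sat_stateAfter (hm _) h2 hz hinj).2 h3⟩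

end KripkeModel

namespace KripkeModel

open Formula FLewAlgebra

theorem sat_reaches {M : KripkeModel.{u, v}} [Nontrivial M.alg] (hM : M.Safe)
    {prog : ℕ → Instr} {m l n : ℕ} {w : M.World} :
    M.Sat w (reaches prog m l n) ↔
      (∀ x, M.R w x → M.eval base x = M.eval base w) ∧
      (∀ x, M.R w x → M.eval floor x = M.eval floor w) ∧
      (∀ x, M.R w x → M.eval input x = M.eval input w) ∧
      ¬ M.eval floor w ≤ M.eval floor w * M.eval base w ∧
      M.Sat w (atLabel l) ∧
      M.Sat w (describesRun prog m) ∧ (∀ x, M.R w x → M.Sat x (describesRun prog m)) ∧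
      M.eval input w = M.eval base w ^ n := by
  have hmul : M.eval (mul floor base) w = M.eval floor w * M.eval base w := rfl
  rw [reaches, reachesAux, sat_and, sat_and, sat_and, sat_and, sat_and, sat_and, sat_and, const,
    const, const, hM.sat_const, hM.sat_const, hM.sat_const, sat_crispNot, sat_imp, hM.sat_box,
    sat_iff, eval_pow, hmul]
  simp only [and_assoc]

/-! ### From models to runs -/

/-- A model of `reaches prog m l n` yields a run to `l`. All times are represented by powers of `a`
above the lower bound, of which there are finitely many, so the part of the model below the root has
finite depth, and each of its worlds describes the configuration at the time given by its height. -/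
theorem exists_run_of_sat {M : KripkeModel.{u, v}} [Nontrivial M.alg] (hM : M.Safe)
    (htrans : ∀ x y z : M.World, M.R x y → M.R y z → M.R x z)
    (harch : M.alg.IsWeaklyArchimedean) {prog : ℕ → Instr} {m l n : ℕ}
    (hm : ∀ i, (prog i).Within m i) (hl : l < m) {w₀ : M.World}
    (h : M.Sat w₀ (reaches prog m l n)) : ∃ t, (Cfg.run prog n t).pc = l := by
  obtain ⟨hA, hZ, hN, hza, hlab, hd₀, hd, hn⟩ := (sat_reaches hM).1 h
  set a := M.eval base w₀ with ha
  set z := M.eval floor w₀ with hz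
  have hza' : z * a ≠ z := fun heq => hza heq.ge
  have hinj : ∀ {i j : ℕ}, z ≤ a ^ i → z ≤ a ^ j → a ^ i = a ^ j → i = j :=
    fun hi hj => pow_inj_of_le harch hza' hi hj
  obtain ⟨N, hNz⟩ : ∃ N, ¬ z ≤ a ^ N := by
    by_contra! hcon
    exact hza' (harch z a hcon)
  have hlt : ∀ k, z ≤ a ^ k → k < N := by
    intro k hk
    by_contra! hle
    exact hNz (hk.trans (pow_anti a hle))
  have hroot : ∀ x, (x = w₀ ∨ M.R w₀ x) → M.eval base x = a ∧ M.eval floor x = z ∧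
      M.eval input x = a ^ n ∧ M.Sat x (describesRun prog m) := by
    rintro x (rfl | hx)
    · exact ⟨rfl, rfl, hn, hd₀⟩
    · exact ⟨hA x hx, hZ x hx, (hN x hx).trans hn, hd x hx⟩
  -- `j` is the length of a chain from the root to `x`, and `k` bounds the height of `x`
  have key : ∀ k j, j + k = N → ∀ x, (x = w₀ ∨ M.R w₀ x) → z ≤ a ^ j * M.eval time x →
      ∃ t, Describes M m a (Cfg.run prog n t) t x := by
    intro k
    induction k with
    | zero =>
      intro j hj x _ hle
      rw [add_zero] at hj
      subst hj
      exact (hNz (hle.trans (mul_le_left' _ _))).elim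
    | succ k ih =>
      intro j hj x hx hle
      obtain ⟨hxa, hxz, hxn, hxd⟩ := hroot x hx
      rw [describesRun, sat_and, sat_and, sat_crispImp, sat_crispImp, sat_crispNot,
        hM.sat_box_zero, sat_aboveFloor hxz] at hxd
      obtain ⟨⟨-, hcnt⟩, hleaf, hstep⟩ := hxd
      by_cases hsucc : ∀ y, ¬ M.R x y
      · exact ⟨0, (sat_initial hxa hxn).1 (hleaf hsucc)⟩
      have hstep := hstep hsucc
      push Not at hsucc
      obtain ⟨y₀, hy₀⟩ := hsucc
      have hS : ∀ y, M.R x y → (y = w₀ ∨ M.R w₀ y) := by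
        rintro y hy
        rcases hx with rfl | hx
        · exact Or.inr hy
        · exact Or.inr (htrans _ _ _ hx hy)
      have hT : M.eval time x = a * M.eval (box time) x := by
        have h1 := hstep
        rw [transition, sat_and, sat_iff] at h1
        exact h1.1.trans (congrArg (· * M.eval (box time) x) hxa)
      have hdesc : ∀ y, M.R x y → ∃ t, Describes M m a (Cfg.run prog n t) t y := by
        intro y hy
        refine ih (j + 1) (by omega) y (hS y hy) (hle.trans ?_)
        rw [hT, ← mul_assoc, ← pow_succ]
        exact mul_mono_right _ (hM.box_le time hy)
      have hT' : ∀ t y, M.R x y → Describes M m a (Cfg.run prog n t) t y → z ≤ a ^ (t + 1) := by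
        intro t y hy hdy
        obtain ⟨-, hyz, -, hyd⟩ := hroot y (hS y hy)
        rw [describesRun, sat_and, sat_aboveFloor hyz, hdy.time] at hyd
        exact hyd.1.1
      let s : Set ℕ := {t | ∃ y, M.R x y ∧ Describes M m a (Cfg.run prog n t) t y}
      have hbdd : BddAbove s := by
        refine ⟨N, ?_⟩
        rintro t ⟨y, hy, hdy⟩
        have := hlt _ (hT' t y hy hdy)
        omega
      have hne : s.Nonempty := by
        obtain ⟨t, ht⟩ := hdesc y₀ hy₀
        exact ⟨t, y₀, hy₀, ht⟩
      obtain ⟨y₁, hy₁, hd₁⟩ := Nat.sSup_mem hne hbdd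
      refine ⟨sSup s + 1, (sat_transition hm hM ⟨⟨y₁, hy₁, hd₁⟩, fun y hy => ?_⟩ ?_ hxa hcnt hinj).1
        hstep⟩
      · obtain ⟨t, ht⟩ := hdesc y hy
        exact ⟨t, le_csSup hbdd ⟨y, hy, ht⟩, ht⟩
      · exact pow_succ_ne_of_le harch hza' ((hT' _ y₁ hy₁ hd₁).trans (pow_anti a (Nat.le_succ _)))
  have hT₀ : z ≤ a ^ 0 * M.eval time w₀ := by
    rw [pow_zero, one_mul]
    rw [describesRun, sat_and, sat_aboveFloor rfl] at hd₀
    exact hd₀.1.1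
  obtain ⟨t, ht⟩ := key N 0 (zero_add N) w₀ (Or.inl rfl) hT₀
  exact ⟨t, ((ht.label l hl).1 hlab).symm⟩

/-! ### From runs to finite models -/

open Classical in
/-- The finite chain of the configurations at the times `0, …, H`, in which a world sees the earlier
times; `K` is the exponent of the lower bound. -/
noncomputable def runModel (A : FLewAlg.{u}) (a : A) (prog : ℕ → Instr) (n H K : ℕ) :
    KripkeModel.{u, v} where
  alg := A
  World := ULift.{v} (Fin (H + 1))
  R x y := y.down < x.down
  val i x :=
    match i with
    | 0 => a
    | 1 => a ^ K
    | 2 => a ^ n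
    | 3 => a ^ (x.down.val + 1)
    | i + 4 =>
      if i % 3 = 0 then a ^ (Cfg.run prog n x.down).cnt (i / 3) true
      else if i % 3 = 1 then a ^ (Cfg.run prog n x.down).cnt (i / 3) false
      else if i / 3 = (Cfg.run prog n x.down).pc then 1 else ⊥

theorem safe_of_finite {M : KripkeModel.{u, v}} [Finite M.World] : M.Safe := by
  have key : ∀ s : Set M.alg, s.Finite → (∃ a, IsGLB s a) ∧ ∃ a, IsLUB s a := by
    intro s hs
    induction s, hs using Set.Finite.induction_on with
    | empty => exact ⟨⟨⊤, isGLB_empty⟩, ⟨⊥, isLUB_empty⟩⟩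
    | @insert b s _ _ ih =>
      obtain ⟨⟨x, hx⟩, ⟨y, hy⟩⟩ := ih
      exact ⟨⟨b ⊓ x, hx.insert b⟩, ⟨b ⊔ y, hy.insert b⟩⟩
  intro φ w
  refine key _ ((Set.finite_range (M.eval φ)).subset ?_)
  rintro b ⟨x, -, rfl⟩
  exact ⟨x, rfl⟩

theorem describes_runModel {A : FLewAlg.{u}} [Nontrivial A] (a : A) (prog : ℕ → Instr)
    (m n H K : ℕ) (x : ULift.{v} (Fin (H + 1))) :
    Describes (runModel.{u, v} A a prog n H K) m a (Cfg.run prog n x.down) x.down x where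
  time := rfl
  cnt r _ b := by
    cases b
    · have h1 : (3 * r + 1) % 3 = 1 := by omega
      have h2 : (3 * r + 1) / 3 = r := by omega
      simp [Formula.cnt, eval, runModel, h1, h2]
      rfl
    · have h1 : (3 * r) % 3 = 0 := by omega
      have h2 : (3 * r) / 3 = r := by omega
      simp [Formula.cnt, eval, runModel, h1, h2]
      rfl
  label i _ := by
    have h1 : (3 * i + 2) % 3 = 2 := by omega
    have h2 : (3 * i + 2) / 3 = i := by omega
    have hbot : (⊥ : A) ≠ 1 := by
      rw [one_eq_top]
      exact bot_ne_top
    have h3 : (runModel.{u, v} A a prog n H K).eval (atLabel i) x =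
        if i = (Cfg.run prog n x.down).pc then (1 : A) else ⊥ := by
      simp [atLabel, eval, runModel, h1, h2]
    refine (iff_of_eq (congrArg (· = 1) h3)).trans ?_
    split_ifs with h
    · exact iff_of_true rfl h
    · exact iff_of_false hbot h

theorem exists_model_of_run {𝒜 : Set FLewAlg.{u}}
    (harch : ∀ A ∈ 𝒜, A.IsWeaklyArchimedean) (hcontr : ∀ n : ℕ, ∃ A ∈ 𝒜, ¬ A.IsContractive n)
    {prog : ℕ → Instr} {m n H : ℕ} (hm : ∀ i, (prog i).Within m i) :
    ∃ M ∈ finTransModels.{u, v} 𝒜, Nontrivial M.alg ∧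
      ∃ w : M.World, M.Sat w (reaches prog m (Cfg.run prog n H).pc n) := by
  -- `K` exceeds the final time and all counters at that time
  obtain ⟨K, hHK, hK⟩ : ∃ K, H + 1 ≤ K ∧ ∀ r < m, ∀ b, (Cfg.run prog n H).cnt r b ≤ K := by
    refine ⟨H + 1 + ∑ r ∈ Finset.range m, ∑ b : Bool, (Cfg.run prog n H).cnt r b, by omega, ?_⟩
    intro r hr b
    have h1 : (Cfg.run prog n H).cnt r b ≤ ∑ b : Bool, (Cfg.run prog n H).cnt r b :=
      Finset.single_le_sum (f := fun b => (Cfg.run prog n H).cnt r b) (fun _ _ => Nat.zero_le _)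
        (Finset.mem_univ b)
    have h2 : ∑ b : Bool, (Cfg.run prog n H).cnt r b ≤
        ∑ r ∈ Finset.range m, ∑ b : Bool, (Cfg.run prog n H).cnt r b :=
      Finset.single_le_sum (f := fun r => ∑ b : Bool, (Cfg.run prog n H).cnt r b)
        (fun _ _ => Nat.zero_le _) (Finset.mem_range.2 hr)
    omega
  obtain ⟨A, hA, hKA⟩ := hcontr K
  rw [FLewAlg.IsContractive] at hKA
  push Not at hKA
  obtain ⟨a, ha⟩ := hKA
  have hnt : Nontrivial A := ⟨_, _, ha⟩
  have hza : a ^ K * a ≠ a ^ K := by rwa [← pow_succ]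
  let M := runModel.{u, v} A a prog n H K
  have hfin : Finite M.World := inferInstanceAs (Finite (ULift (Fin (H + 1))))
  have hntM : Nontrivial M.alg := hnt
  have hM : M.Safe := safe_of_finite
  have htrans : ∀ x y z : M.World, M.R x y → M.R y z → M.R x z :=
    fun x y z hxy hyz => lt_trans (show z.down < y.down from hyz) (show y.down < x.down from hxy)
  refine ⟨M, ⟨⟨⟨hA, hM⟩, htrans⟩, hfin⟩, hntM, ⟨Fin.last H⟩, ?_⟩
  have hDesc : ∀ x : M.World, Describes M m a (Cfg.run prog n x.down.val) x.down.val x :=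
    fun x => describes_runModel a prog m n H K x
  have hbase : ∀ x, M.eval base x = a := fun _ => rfl
  have hinput : ∀ x, M.eval input x = a ^ n := fun _ => rfl
  have hfloor : ∀ x, M.eval floor x = a ^ K := fun _ => rfl
  have hinj : ∀ {i j : ℕ}, a ^ K ≤ a ^ i → a ^ K ≤ a ^ j → a ^ i = a ^ j → i = j :=
    fun hi hj => pow_inj_of_le (harch A hA) hza hi hj
  have hruns : ∀ x : M.World, M.Sat x (describesRun prog m) := by
    intro x
    have hxH : x.down.val ≤ H := Nat.le_of_lt_succ x.down.isLt
    have hcnt : ∀ r < m, ∀ b, a ^ K ≤ M.eval (cnt r b) x := by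
      intro r hr b
      rw [(hDesc x).cnt r hr]
      exact pow_anti a ((Cfg.monotone_run_cnt prog n r b hxH).trans (hK r hr b))
    rw [describesRun, sat_and, sat_and, sat_crispImp, sat_crispImp, sat_crispNot,
      hM.sat_box_zero, sat_aboveFloor (hfloor x)]
    refine ⟨⟨?_, hcnt⟩, fun hno => ?_, fun hsucc => ?_⟩
    · rw [(hDesc x).time]
      exact pow_anti a (by omega)
    · have hx : x.down.val = 0 := by
        by_contra hne
        exact hno ⟨0⟩ (Fin.pos_iff_ne_zero.2 fun h0 => hne (by rw [h0]; rfl))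
      have := hDesc x
      rw [hx] at this
      exact (sat_initial (hbase x) (hinput x)).2 this
    · push Not at hsucc
      obtain ⟨y, hy⟩ := hsucc
      have hy : y.down.val < x.down.val := hy
      obtain ⟨t, ht⟩ : ∃ t, x.down.val = t + 1 := ⟨x.down.val - 1, by omega⟩
      refine (sat_transition hm hM (t := t)
        ⟨⟨⟨⟨t, by omega⟩⟩, ?_, hDesc ⟨⟨t, by omega⟩⟩⟩, fun y hy => ?_⟩ ?_ (hbase x) hcnt hinj).2 ?_
      · exact Fin.lt_def.2 (by simp only; omega)
      · have hy : y.down.val < x.down.val := hy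
        exact ⟨_, by omega, hDesc y⟩
      · exact pow_succ_ne_of_le (harch A hA) hza (pow_anti a (by omega))
      · rw [← ht]
        exact hDesc x
  have hlabel := (hDesc ⟨Fin.last H⟩).label _ (Cfg.run_pc_lt hm n H)
  exact (sat_reaches hM).2 ⟨fun _ _ => rfl, fun _ _ => rfl, fun _ _ => rfl,
    fun hle => hza (le_antisymm (mul_le_left' _ _) hle), hlabel.2 rfl, hruns _,
    fun x _ => hruns x, rfl⟩

end KripkeModel

/-! ### While programs -/

/-- While programs over integer registers. -/
inductive Prog : Type where
  | skip : Prog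
  | add (r s : ℕ) : Prog
  | sub (r s : ℕ) : Prog
  | seq (p q : Prog) : Prog
  | loop (r : ℕ) (p : Prog) : Prog

namespace Prog

/-- `p.Run σ τ`: the program `p`, started with register contents `σ`, terminates with `τ`. -/
inductive Run : Prog → (ℕ → ℤ) → (ℕ → ℤ) → Prop where
  | skip {σ} : Run skip σ σ
  | add {σ} (r s : ℕ) : Run (add r s) σ (Function.update σ r (σ r + σ s))
  | sub {σ} (r s : ℕ) : Run (sub r s) σ (Function.update σ r (σ r - σ s))
  | seq {p q σ τ υ} : Run p σ τ → Run q τ υ → Run (seq p q) σ υ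
  | loop_done {r p σ} : σ r = 0 → Run (loop r p) σ σ
  | loop_step {r p σ τ υ} : σ r ≠ 0 → Run p σ τ → Run (loop r p) τ υ → Run (loop r p) σ υ

/-- The number of instructions of a compiled program. -/
def size : Prog → ℕ
  | skip => 0
  | add _ _ => 1
  | sub _ _ => 1
  | seq p q => p.size + q.size
  | loop _ p => p.size + 2

/-- The instruction at label `i` of the program compiled to start at label `o`. Loops are tested
both on entry and after the body. -/
def compile : Prog → ℕ → ℕ → Instr
  | skip, _, _ => .test 0 0 0
  | add r s, _, _ => .add r s
  | sub r s, _, _ => .sub r s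
  | seq p q, o, i => if i < o + p.size then p.compile o i else q.compile (o + p.size) i
  | loop r p, o, i =>
    if o < i ∧ i < o + 1 + p.size then p.compile (o + 1) i
    else .test r (o + p.size + 2) (o + 1)

/-- `prog` contains the compiled program `p` from label `o` on. -/
def LoadedAt (prog : ℕ → Instr) (p : Prog) (o : ℕ) : Prop :=
  ∀ i, o ≤ i → i < o + p.size → prog i = p.compile o i

end Prog

/-- The content of register `r`. -/
def Cfg.reg (c : Cfg) (r : ℕ) : ℤ := c.cnt r true - c.cnt r false

namespace Prog

/-- The machine gets from label `o` with contents `σ` to label `o'` with contents `τ`. -/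
def Leads (prog : ℕ → Instr) (o : ℕ) (σ : ℕ → ℤ) (o' : ℕ) (τ : ℕ → ℤ) : Prop :=
  ∀ c : Cfg, c.pc = o → c.reg = σ → ∃ t, ((Cfg.step prog)^[t] c).pc = o' ∧
    ((Cfg.step prog)^[t] c).reg = τ

variable {prog : ℕ → Instr}

theorem Leads.refl (o : ℕ) (σ : ℕ → ℤ) : Leads prog o σ o σ := fun _ h₁ h₂ => ⟨0, h₁, h₂⟩

theorem Leads.trans {o₁ o₂ o₃ : ℕ} {σ₁ σ₂ σ₃ : ℕ → ℤ} (h : Leads prog o₁ σ₁ o₂ σ₂)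
    (h' : Leads prog o₂ σ₂ o₃ σ₃) : Leads prog o₁ σ₁ o₃ σ₃ := by
  intro c h₁ h₂
  obtain ⟨t, ht₁, ht₂⟩ := h c h₁ h₂
  obtain ⟨t', ht₁', ht₂'⟩ := h' _ ht₁ ht₂
  refine ⟨t' + t, ?_⟩
  rw [Function.iterate_add_apply]
  exact ⟨ht₁', ht₂'⟩

theorem leads_add {o r s : ℕ} (h : prog o = .add r s) (σ : ℕ → ℤ) :
    Leads prog o σ (o + 1) (Function.update σ r (σ r + σ s)) := by
  rintro c rfl rfl
  refine ⟨1, ?_, ?_⟩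
  · simp [Cfg.step, h, Instr.next]
  · funext r'
    by_cases hr : r' = r
    · subst hr
      simp [Cfg.step, h, Instr.update, Instr.source, Cfg.reg]
      ring
    · simp [Cfg.step, h, Instr.update, Instr.source, Cfg.reg, hr]

theorem leads_sub {o r s : ℕ} (h : prog o = .sub r s) (σ : ℕ → ℤ) :
    Leads prog o σ (o + 1) (Function.update σ r (σ r - σ s)) := by
  rintro c rfl rfl
  refine ⟨1, ?_, ?_⟩
  · simp [Cfg.step, h, Instr.next]
  · funext r'
    by_cases hr : r' = r
    · subst hr
      simp [Cfg.step, h, Instr.update, Instr.source, Cfg.reg]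
      ring
    · simp [Cfg.step, h, Instr.update, Instr.source, Cfg.reg, hr]

theorem step_test {r l l' : ℕ} {c : Cfg} (h : prog c.pc = .test r l l') :
    (Cfg.step prog c).pc = (if c.reg r = 0 then l else l') ∧ (Cfg.step prog c).reg = c.reg := by
  have hiff : c.reg r = 0 ↔ c.cnt r true = c.cnt r false := by
    rw [Cfg.reg]
    omega
  refine ⟨?_, ?_⟩
  · simp [Cfg.step, h, Instr.next, Instr.update, Instr.source, hiff]
  · funext r'
    simp [Cfg.step, h, Instr.update, Instr.source, Cfg.reg]

theorem leads_test {o r l l' : ℕ} (h : prog o = .test r l l') (σ : ℕ → ℤ) :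
    Leads prog o σ (if σ r = 0 then l else l') σ := by
  rintro c rfl rfl
  exact ⟨1, step_test h⟩

theorem LoadedAt.left {p q : Prog} {o : ℕ} (h : LoadedAt prog (seq p q) o) : LoadedAt prog p o := by
  intro i h₁ h₂
  rw [h i h₁ (by simp only [size]; omega), compile, if_pos h₂]

theorem LoadedAt.right {p q : Prog} {o : ℕ} (h : LoadedAt prog (seq p q) o) :
    LoadedAt prog q (o + p.size) := by
  intro i h₁ h₂
  rw [h i (by omega) (by simp only [size]; omega), compile, if_neg (by omega)]

theorem LoadedAt.body {p : Prog} {r o : ℕ} (h : LoadedAt prog (loop r p) o) :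
    LoadedAt prog p (o + 1) := by
  intro i h₁ h₂
  rw [h i (by omega) (by simp only [size]; omega), compile, if_pos (by omega)]

theorem LoadedAt.entry {p : Prog} {r o : ℕ} (h : LoadedAt prog (loop r p) o) :
    prog o = .test r (o + p.size + 2) (o + 1) := by
  rw [h o le_rfl (by simp only [size]; omega), compile, if_neg (by omega)]

theorem LoadedAt.exit {p : Prog} {r o : ℕ} (h : LoadedAt prog (loop r p) o) :
    prog (o + 1 + p.size) = .test r (o + p.size + 2) (o + 1) := by
  rw [h _ (by omega) (by simp only [size]; omega), compile, if_neg (by omega)]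

theorem Run.leads {p : Prog} {σ τ : ℕ → ℤ} (h : Run p σ τ) :
    ∀ o, LoadedAt prog p o → Leads prog o σ (o + p.size) τ := by
  induction h with
  | skip => exact fun o _ => Leads.refl o _
  | add r s => exact fun o ho => leads_add (ho o le_rfl (by simp [size])) _
  | sub r s => exact fun o ho => leads_sub (ho o le_rfl (by simp [size])) _
  | seq _ _ ih₁ ih₂ =>
    intro o ho
    have := (ih₁ o ho.left).trans (ih₂ _ ho.right)
    rwa [add_assoc] at this
  | @loop_done r p σ h₀ =>
    intro o ho
    have := leads_test ho.entry σ
    rw [if_pos h₀] at this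
    exact this
  | @loop_step r p σ τ υ h₀ _ _ ih₁ ih₂ =>
    intro o ho
    have h₁ := leads_test ho.entry σ
    rw [if_neg h₀] at h₁
    have h₂ := ih₁ (o + 1) ho.body
    -- after the body, the loop continues as it does from its entry
    refine (h₁.trans h₂).trans fun c hc hσ => ?_
    obtain ⟨t, ht₁, ht₂⟩ := ih₂ o ho ⟨o, c.cnt⟩ rfl hσ
    have hstep : Cfg.step prog c = Cfg.step prog ⟨o, c.cnt⟩ := by
      have hc' : prog c.pc = .test r (o + p.size + 2) (o + 1) := by rw [hc, ho.exit]
      simp [Cfg.step, hc', ho.entry, Instr.next]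
    cases t with
    | zero =>
      simp only [Function.iterate_zero, id, size] at ht₁
      omega
    | succ t =>
      refine ⟨t + 1, ?_⟩
      rw [Function.iterate_succ_apply, hstep, ← Function.iterate_succ_apply]
      exact ⟨ht₁, ht₂⟩

/-- The machine that runs the compiled program and then stays at its end. -/
def machine (p : Prog) (i : ℕ) : Instr :=
  if i < p.size then p.compile 0 i else .test 0 p.size p.size

theorem loadedAt_machine (p : Prog) : LoadedAt p.machine p 0 := by
  intro i _ h
  rw [machine, if_pos (by omega)]

theorem exists_within_machine (p : Prog) : ∃ m, p.size < m ∧ ∀ i, (p.machine i).Within m i := by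
  have hmono : ∀ {m m' i : ℕ} {ins : Instr}, m ≤ m' → ins.Within m i → ins.Within m' i := by
    intro m m' i ins hm h
    cases ins <;> simp only [Instr.Within] at h ⊢ <;> omega
  have hone : ∀ i ins, ∃ m, Instr.Within m i ins := by
    intro i ins
    cases ins with
    | add r s => exact ⟨r + s + i + 2, by simp only [Instr.Within]; omega⟩
    | sub r s => exact ⟨r + s + i + 2, by simp only [Instr.Within]; omega⟩
    | test r l l' => exact ⟨r + l + l' + 1, by simp only [Instr.Within]; omega⟩
  choose m hm using hone
  refine ⟨p.size + 1 + ∑ i ∈ Finset.range p.size, m i (p.machine i), by omega, fun i => ?_⟩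
  by_cases hi : i < p.size
  · have := Finset.single_le_sum (f := fun i => m i (p.machine i)) (fun _ _ => Nat.zero_le _)
      (Finset.mem_range.2 hi)
    exact hmono (by omega) (hm i (p.machine i))
  · rw [machine, if_neg hi]
    simp only [Instr.Within]
    omega

end Prog

/-! ### Primitive recursive functions are computed by while programs -/

namespace Prog

/-- The contents `σ` are ready for a subroutine that reads the arguments `v` from the registers `ρ`,
writes to `o`, and uses the registers from `s` on as scratch. Register `0` holds the constant `1`.
-/
structure Ready {n : ℕ} (ρ : Fin n → ℕ) (o s : ℕ) (v : List.Vector ℕ n) (σ : ℕ → ℤ) : Prop where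
  one : σ 0 = 1
  arg : ∀ i, σ (ρ i) = v.get i
  out : σ o = 0
  scratch : ∀ r, s ≤ r → σ r = 0

/-- `f` is computed by a subroutine that can be placed at any registers. It leaves all registers but
the output register as they were, and in particular clears its scratch registers. -/
def Computes {n : ℕ} (f : List.Vector ℕ n → ℕ) : Prop :=
  ∀ (ρ : Fin n → ℕ) (o s : ℕ), o ≠ 0 → o < s → (∀ i, ρ i < s) → (∀ i, ρ i ≠ o) →
    ∃ p : Prog, ∀ v σ, Ready ρ o s v σ → Run p σ (Function.update σ o (f v))

theorem Run.of_eq {p : Prog} {σ τ τ' : ℕ → ℤ} (h : Run p σ τ) (h' : ∀ r, τ r = τ' r) :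
    Run p σ τ' :=
  funext h' ▸ h

theorem exists_run_clear (s j : ℕ) :
    ∃ p : Prog, ∀ σ, Run p σ fun r => if s ≤ r ∧ r < s + j then 0 else σ r := by
  induction j with
  | zero => exact ⟨skip, fun σ => Run.skip.of_eq fun r => (if_neg (by omega)).symm⟩
  | succ j ih =>
    obtain ⟨p, hp⟩ := ih
    refine ⟨seq p (sub (s + j) (s + j)), fun σ => ((hp σ).seq (Run.sub _ _)).of_eq fun r => ?_⟩
    rw [Function.update_apply]
    split_ifs <;> omega

theorem exists_run_args {m : ℕ} {g : ℕ → List.Vector ℕ m → ℕ} {ρ : Fin m → ℕ} {o s n j : ℕ}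
    (hs : 0 < s) (hρ : ∀ i, ρ i < s) (hj : j ≤ n) (hg : ∀ i < n, Computes (g i)) :
    ∃ p : Prog, ∀ v σ, Ready ρ o s v σ →
      Run p σ fun r => if s ≤ r ∧ r < s + j then (g (r - s) v : ℤ) else σ r := by
  induction j with
  | zero => exact ⟨skip, fun v σ _ => Run.skip.of_eq fun r => (if_neg (by omega)).symm⟩
  | succ j ih =>
    obtain ⟨p, hp⟩ := ih (by omega)
    obtain ⟨q, hq⟩ := hg j (by omega) ρ (s + j) (s + n) (by omega) (by omega)
      (fun i => (hρ i).trans_le (by omega)) (fun i => by have := hρ i; omega)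
    refine ⟨seq p q, fun v σ h =>
      ((hp v σ h).seq (hq v _ ⟨?_, fun i => ?_, ?_, fun r hr => ?_⟩)).of_eq fun r => ?_⟩
    · rw [if_neg (by omega), h.one]
    · have := hρ i
      rw [if_neg (by omega), h.arg]
    · rw [if_neg (by omega), h.scratch _ (by omega)]
    · rw [if_neg (by omega), h.scratch _ (by omega)]
    · rw [Function.update_apply]
      by_cases hr : r = s + j
      · subst hr
        rw [if_pos rfl, if_pos (by omega), Nat.add_sub_cancel_left]
      · rw [if_neg hr]
        exact if_congr (by omega) rfl rfl

theorem Computes.comp {m n : ℕ} {f : List.Vector ℕ n → ℕ} {g : Fin n → List.Vector ℕ m → ℕ}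
    (hf : Computes f) (hg : ∀ i, Computes (g i)) :
    Computes fun v => f (List.Vector.ofFn fun i => g i v) := by
  intro ρ o s ho hos hρ hρo
  let G : ℕ → List.Vector ℕ m → ℕ := fun i => if h : i < n then g ⟨i, h⟩ else fun _ => 0
  have hG : ∀ i : Fin n, G i = g i := fun i => dif_pos i.isLt
  obtain ⟨p, hp⟩ := exists_run_args (g := G) (o := o) (s := s) (n := n) (j := n) (by omega) hρ
    le_rfl fun i hi => by
      have := hG ⟨i, hi⟩
      simp only at this
      rw [this]
      exact hg _
  obtain ⟨q, hq⟩ := hf (fun i => s + i) o (s + n) ho (by omega) (fun i => by omega)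
    (fun i => by omega)
  obtain ⟨c, hc⟩ := exists_run_clear s n
  refine ⟨seq p (seq q c), fun v σ h => ((hp v σ h).seq ((hq (List.Vector.ofFn fun i => g i v) _
    ⟨?_, fun i => ?_, ?_, fun r hr => ?_⟩).seq (hc _))).of_eq fun r => ?_⟩
  · rw [if_neg (by omega), h.one]
  · have := i.isLt
    rw [if_pos (by omega), Nat.add_sub_cancel_left, hG, List.Vector.get_ofFn]
  · rw [if_neg (by omega), h.out]
  · rw [if_neg (by omega), h.scratch _ (by omega)]
  · simp only [Function.update_apply]
    by_cases hr : r = o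
    · rw [if_neg (by omega), if_pos hr, if_pos hr]
    · rw [if_neg hr, if_neg hr]
      split_ifs with h'
      · exact (h.scratch r h'.1).symm
      · rfl

theorem Computes.prec {n : ℕ} {f : List.Vector ℕ n → ℕ} {g : List.Vector ℕ (n + 2) → ℕ}
    (hf : Computes f) (hg : Computes g) :
    Computes fun v : List.Vector ℕ (n + 1) =>
      v.head.rec (f v.tail) fun y IH => g (y ::ᵥ IH ::ᵥ v.tail) := by
  intro ρ o s ho hos hρ hρo
  have hρ' : ∀ i : Fin n, ρ i.succ < s := fun i => hρ _
  have hρ₀ := hρ 0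
  -- `s` counts up, `s + 1` accumulates, `s + 2` counts down, `s + 3` receives the next value
  obtain ⟨p, hp⟩ := hf (fun i => ρ i.succ) (s + 1) (s + 4) (by omega) (by omega)
    (fun i => by have := hρ' i; omega) (fun i => by have := hρ' i; omega)
  obtain ⟨q, hq⟩ := hg (Fin.cons s (Fin.cons (s + 1) fun i => ρ i.succ)) (s + 3) (s + 4) (by omega)
    (by omega)
    (Fin.cases (by simp) (Fin.cases (by simp) fun i => by
      have := hρ' i; simp only [Fin.cons_succ]; omega))
    (Fin.cases (by simp) (Fin.cases (by simp) fun i => by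
      have := hρ' i; simp only [Fin.cons_succ]; omega))
  refine ⟨seq (add (s + 2) (ρ 0)) (seq p (seq (loop (s + 2) (seq (sub (s + 2) 0) (seq q
    (seq (sub (s + 1) (s + 1)) (seq (add (s + 1) (s + 3)) (seq (sub (s + 3) (s + 3)) (add s 0)))))))
    (seq (sub s s) (seq (add o (s + 1)) (sub (s + 1) (s + 1)))))), fun v σ h => ?_⟩
  set N := v.head with hN
  set F : ℕ → ℕ := fun k => Nat.rec (f v.tail) (fun y IH => g (y ::ᵥ IH ::ᵥ v.tail)) k with hF
  have hF₀ : F 0 = f v.tail := rfl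
  have hF₁ : ∀ k, F (k + 1) = g (k ::ᵥ F k ::ᵥ v.tail) := fun _ => rfl
  let S : ℕ → ℕ → ℤ := fun j r => if r = s then (j : ℤ) else if r = s + 1 then (F j : ℤ)
    else if r = s + 2 then (N : ℤ) - j else σ r
  have hS : ∀ j r, S j r = if r = s then (j : ℤ) else if r = s + 1 then (F j : ℤ)
    else if r = s + 2 then (N : ℤ) - j else σ r := fun _ _ => rfl
  have hσ0 := h.one
  have hσs := h.scratch s le_rfl
  have hσ1 := h.scratch (s + 1) (by omega)
  have hσ2 := h.scratch (s + 2) (by omega)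
  have hσ3 := h.scratch (s + 3) (by omega)
  have hσo := h.out
  have harg : σ (ρ 0) = N := by rw [h.arg 0, hN, List.Vector.get_zero]
  have htail : ∀ i : Fin n, σ (ρ i.succ) = v.tail.get i := fun i => by
    rw [h.arg, List.Vector.get_tail_succ]
  have hloop : ∀ d j, j + d = N → Run (loop (s + 2) (seq (sub (s + 2) 0) (seq q
      (seq (sub (s + 1) (s + 1)) (seq (add (s + 1) (s + 3)) (seq (sub (s + 3) (s + 3))
      (add s 0))))))) (S j) (S N) := by
    intro d
    induction d with
    | zero =>
      rintro j hj
      rw [add_zero] at hj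
      rw [hj]
      refine Run.loop_done ?_
      rw [hS]
      simp
    | succ d ih =>
      intro j hj
      refine Run.loop_step (τ := S (j + 1)) ?_ ?_ (ih (j + 1) (by omega))
      · rw [hS]
        simp
        omega
      · refine (Run.seq (Run.sub _ _) (Run.seq (hq (j ::ᵥ F j ::ᵥ v.tail) _
          ⟨?_, ?_, ?_, fun r hr => ?_⟩) (Run.seq (Run.sub _ _) (Run.seq (Run.add _ _)
          (Run.seq (Run.sub _ _) (Run.add _ _)))))).of_eq fun r => ?_
        · rw [Function.update_apply, if_neg (by omega), hS, if_neg (by omega), if_neg (by omega),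
            if_neg (by omega), h.one]
        · refine Fin.cases ?_ (Fin.cases ?_ fun i => ?_)
          · simp [hS]
          · simp [hS]
            rfl
          · have := hρ' i
            simp only [Fin.cons_succ, List.Vector.get_cons_succ]
            rw [Function.update_apply, if_neg (by omega), hS, if_neg (by omega), if_neg (by omega),
              if_neg (by omega), htail]
        · rw [Function.update_apply, if_neg (by omega), hS, if_neg (by omega), if_neg (by omega),
            if_neg (by omega), hσ3]
        · rw [Function.update_apply, if_neg (by omega), hS, if_neg (by omega), if_neg (by omega),
            if_neg (by omega), h.scratch r (by omega)]
        · rw [← hF₁]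
          have h0s : (0 : ℕ) ≠ s := by omega
          simp only [Function.update_apply, hS]
          simp
          split_ifs <;> simp_all
          all_goals omega
  have hstart : Function.update (Function.update σ (s + 2) (σ (s + 2) + σ (ρ 0))) (s + 1)
      (f v.tail : ℤ) = S 0 := by
    funext r
    simp only [Function.update_apply, hS, hF₀]
    split_ifs <;> simp_all
  have hloop₀ := hloop N 0 (zero_add N)
  rw [← hstart] at hloop₀
  refine (Run.seq (Run.add _ _) (Run.seq (hp v.tail _ ⟨?_, fun i => ?_, ?_, fun r hr => ?_⟩)
    (Run.seq hloop₀ (Run.seq (Run.sub _ _) (Run.seq (Run.add _ _) (Run.sub _ _)))))).of_eq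
    fun r => ?_
  · rw [Function.update_apply, if_neg (by omega), h.one]
  · have := hρ' i
    rw [Function.update_apply, if_neg (by omega), htail]
  · rw [Function.update_apply, if_neg (by omega), hσ1]
  · rw [Function.update_apply, if_neg (by omega), h.scratch r (by omega)]
  · have hos' : o ≠ s := by omega
    have hos1 : o ≠ s + 1 := by omega
    have hos2 : o ≠ s + 2 := by omega
    simp only [Function.update_apply, hS]
    split_ifs <;> simp_all

theorem computes_of_primrec' {n : ℕ} {f : List.Vector ℕ n → ℕ} (hf : Nat.Primrec' f) :
    Computes f := by
  induction hf with
  | zero =>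
    refine fun ρ o s _ _ _ _ => ⟨skip, fun v σ h => Run.skip.of_eq fun r => ?_⟩
    rw [Function.update_apply]
    split_ifs with hr
    · rw [hr, h.out, Nat.cast_zero]
    · rfl
  | succ =>
    refine fun ρ o s ho _ _ _ => ⟨seq (add o (ρ 0)) (add o 0), fun v σ h =>
      (Run.seq (Run.add _ _) (Run.add _ _)).of_eq fun r => ?_⟩
    have harg : σ (ρ 0) = v.head := by rw [h.arg 0, List.Vector.get_zero]
    simp only [Function.update_apply, h.out, h.one, harg, if_neg ho.symm]
    split_ifs <;> simp
  | get i =>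
    refine fun ρ o s _ _ _ _ => ⟨add o (ρ i), fun v σ h => (Run.add _ _).of_eq fun r => ?_⟩
    rw [h.out, h.arg, zero_add]
  | comp g _ _ hf hg => exact hf.comp hg
  | prec _ _ hf hg => exact hf.prec hg

end Prog

/-! ### Undecidability of the halting of counter machines -/

namespace Prog

/-- Unbounded search by a while program: its machine halts on the input `n` if and only if `g n` has
a zero. -/
theorem exists_search {g : ℕ → ℕ → ℕ} (hg : Primrec₂ g) :
    ∃ p : Prog, ∀ n, (∃ t, (Cfg.run p.machine n t).pc = p.size) ↔ ∃ k, g n k = 0 := by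
  -- register `1` holds the input, `2` the candidate `k`, and `3` the value `g n k`
  obtain ⟨p, hp⟩ := computes_of_primrec' (Nat.Primrec'.prim_iff₂.2 hg) ![1, 2] 3 4 (by omega)
    (by omega) (by simp [Fin.forall_fin_two]) (by simp [Fin.forall_fin_two])
  let body : Prog := seq (sub 3 3) (seq (add 2 0) p)
  let P : Prog := seq p (loop 3 body)
  refine ⟨P, fun n => ?_⟩
  let S : ℕ → ℕ → ℤ := fun k r => if r = 0 then 1 else if r = 1 then (n : ℤ) else if r = 2 then k
    else if r = 3 then (g n k : ℤ) else 0
  have hS : ∀ k r, S k r = if r = 0 then 1 else if r = 1 then (n : ℤ) else if r = 2 then (k : ℤ)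
    else if r = 3 then (g n k : ℤ) else 0 := fun _ _ => rfl
  have hfirst : Run p (Cfg.init n).reg (S 0) := by
    refine (hp (n ::ᵥ 0 ::ᵥ List.Vector.nil) _ ⟨?_, ?_, ?_, fun r hr => ?_⟩).of_eq fun r => ?_
    · simp [Cfg.reg, Cfg.init]
    · simp only [Fin.forall_fin_two]
      exact ⟨by simp [Cfg.reg, Cfg.init], rfl⟩
    · simp [Cfg.reg, Cfg.init]
    · have h0 : r ≠ 0 := by omega
      have h1 : r ≠ 1 := by omega
      simp [Cfg.reg, Cfg.init, h0, h1]
    · simp only [Function.update_apply, hS, Cfg.reg, Cfg.init]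
      split_ifs <;> simp_all
  have hbody : ∀ k, Run body (S k) (S (k + 1)) := by
    intro k
    refine (Run.seq (Run.sub _ _) (Run.seq (Run.add _ _) (hp (n ::ᵥ (k + 1) ::ᵥ List.Vector.nil) _
      ⟨?_, ?_, ?_, fun r hr => ?_⟩))).of_eq fun r => ?_
    · simp [hS]
    · simp only [Fin.forall_fin_two]
      exact ⟨by simp [hS], by simp [hS]; rfl⟩
    · simp [hS]
    · have h2 : r ≠ 2 := by omega
      have h3 : r ≠ 3 := by omega
      simp only [Function.update_apply, hS, if_neg h2, if_neg h3]
      rw [if_neg (by omega), if_neg (by omega)]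
    · by_cases h3 : r = 3
      · simp [h3, hS]
      · by_cases h2 : r = 2
        · simp [h2, hS]
        · simp [h2, h3, hS]
  have hloaded := loadedAt_machine P
  constructor
  · rintro ⟨H, hH⟩
    by_contra! hne
    have hstay : ∀ t, (Cfg.run P.machine n (H + t)).pc = P.size := by
      intro t
      induction t with
      | zero => exact hH
      | succ t ih =>
        have htest : P.machine (Cfg.run P.machine n (H + t)).pc = .test 0 P.size P.size := by
          rw [ih, machine, if_neg (lt_irrefl _)]
        rw [← add_assoc, Cfg.run_succ, (step_test htest).1, ite_self]
    -- the run passes the test at the end of the loop infinitely often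
    have hright := hloaded.right
    have hpass : ∀ k, ∃ t, k ≤ t ∧ (Cfg.run P.machine n t).pc = 0 + p.size + 1 + body.size ∧
        (Cfg.run P.machine n t).reg = S (k + 1) := by
      intro k
      induction k with
      | zero =>
        have h1 := hfirst.leads 0 hloaded.left
        have h2 := leads_test hright.entry (S 0)
        rw [if_neg (by simpa [hS] using hne 0)] at h2
        have h3 := (hbody 0).leads _ hright.body
        obtain ⟨t, ht⟩ := (h1.trans (h2.trans h3)) (Cfg.init n) rfl rfl
        exact ⟨t, Nat.zero_le t, ht⟩
      | succ k ih =>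
        obtain ⟨t, hkt, hpc, hreg⟩ := ih
        have htest := hright.exit
        rw [← hpc] at htest
        have hstep := step_test htest
        rw [hreg, if_neg (by simpa [hS] using hne (k + 1)), ← Cfg.run_succ] at hstep
        obtain ⟨t', ht'⟩ := (hbody (k + 1)).leads _ hright.body _ hstep.1 hstep.2
        refine ⟨t' + (t + 1), by omega, ?_⟩
        rw [Cfg.run, Function.iterate_add_apply]
        exact ht'
    obtain ⟨t, ht, hpc, -⟩ := hpass H
    have := hstay (t - H)
    rw [Nat.add_sub_cancel' ht, hpc] at this
    simp only [P, size] at this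
    omega
  · intro hex
    have hloop : ∀ d k, k + d = Nat.find hex → Run (loop 3 body) (S k) (S (Nat.find hex)) := by
      intro d
      induction d with
      | zero =>
        intro k hk
        rw [add_zero] at hk
        rw [hk]
        refine Run.loop_done ?_
        simpa [hS] using Nat.find_spec hex
      | succ d ih =>
        intro k hk
        refine Run.loop_step ?_ (hbody k) (ih (k + 1) (by omega))
        simpa [hS] using Nat.find_min hex (show k < Nat.find hex by omega)
    obtain ⟨t, ht, -⟩ := (hfirst.seq (hloop _ 0 (zero_add _))).leads 0 hloaded (Cfg.init n) rfl rfl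
    exact ⟨t, ht.trans (zero_add _)⟩

end Prog

/-- There is a machine for which halting on a given input is undecidable. -/
theorem exists_undecidable_prog :
    ∃ p : Prog, ¬ ComputablePred fun n : ℕ => ∃ t, (Cfg.run p.machine n t).pc = p.size := by
  let g : ℕ → ℕ → ℕ := fun n k =>
    if (Nat.Partrec.Code.evaln k (Denumerable.ofNat Nat.Partrec.Code n) 0).isSome then 0 else 1
  have hg : Primrec₂ g := by
    have h1 : Primrec fun x : ℕ × ℕ =>
        Nat.Partrec.Code.evaln x.2 (Denumerable.ofNat Nat.Partrec.Code x.1) 0 :=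
      Nat.Partrec.Code.primrec_evaln.comp
        (.pair (.pair .snd ((Primrec.ofNat _).comp .fst)) (.const 0))
    exact Primrec.ite (Primrec.eq.comp (Primrec.option_isSome.comp h1) (.const true)) (.const 0)
      (.const 1)
  obtain ⟨p, hp⟩ := Prog.exists_search hg
  refine ⟨p, fun h => ComputablePred.halting_problem 0 ?_⟩
  have hcode : ∀ c : Nat.Partrec.Code, (Nat.Partrec.Code.eval c 0).Dom ↔
      ∃ t, (Cfg.run p.machine (Encodable.encode c) t).pc = p.size := by
    intro c
    rw [hp, Part.dom_iff_mem]
    simp only [g, Denumerable.ofNat_encode, Nat.Partrec.Code.evaln_complete, ite_eq_left_iff,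
      one_ne_zero, imp_false, not_not, Option.isSome_iff_exists]
    exact exists_comm
  exact ComputablePred.computable_of_manyOneReducible
    ⟨Encodable.encode, Computable.encode, hcode⟩ h

/-! ### Computability of the reduction -/

namespace Formula

theorem primrec₂_and : Primrec₂ and :=
  (Primrec.of_equiv_iff equivNat).1 <|
    Primrec.nat_add.comp (Primrec.nat_mul.comp (.const 8) (Primrec₂.natPair.comp
      ((Primrec.of_equiv (e := equivNat)).comp .fst)
      ((Primrec.of_equiv (e := equivNat)).comp .snd)))
      (.const 6)

theorem primrec₂_mul : Primrec₂ mul :=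
  (Primrec.of_equiv_iff equivNat).1 <|
    Primrec.nat_add.comp (Primrec.nat_mul.comp (.const 8) (Primrec₂.natPair.comp
      ((Primrec.of_equiv (e := equivNat)).comp .fst)
      ((Primrec.of_equiv (e := equivNat)).comp .snd)))
      (.const 8)

theorem primrec₂_imp : Primrec₂ imp :=
  (Primrec.of_equiv_iff equivNat).1 <|
    Primrec.nat_add.comp (Primrec.nat_mul.comp (.const 8) (Primrec₂.natPair.comp
      ((Primrec.of_equiv (e := equivNat)).comp .fst)
      ((Primrec.of_equiv (e := equivNat)).comp .snd)))
      (.const 9)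

theorem primrec_delta : Primrec delta :=
  (Primrec.of_equiv_iff equivNat).1 <|
    Primrec.nat_add.comp (Primrec.nat_mul.comp (.const 8) (Primrec.of_equiv (e := equivNat)))
      (.const 5)

theorem primrec_crispNot : Primrec crispNot :=
  primrec₂_imp.comp primrec_delta (.const zero)

theorem primrec_pow (φ : Formula) : Primrec (pow φ) :=
  (Primrec.nat_rec₁ one (primrec₂_mul.comp (.const φ) Primrec.snd).to₂).of_eq fun n => by
    induction n with
    | zero => rfl
    | succ n ih => simp only [pow, ← ih]

theorem primrec_reaches (prog : ℕ → Instr) (m l : ℕ) : Primrec (reaches prog m l) :=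
  have h := primrec_pow base
  primrec₂_and.comp (.const _)
    (primrec₂_and.comp (primrec₂_imp.comp (.const input) h) (primrec₂_imp.comp h (.const input)))

end Formula

open KripkeModel Formula in
/-- For any class `C` of models between the finite transitive and the transitive ones over `𝒜`, the
machine reaches `l` if and only if `reaches` is satisfied at a world of a model in `C` whose algebra
is nontrivial. -/
theorem exists_sat_reaches_iff {𝒜 : Set FLewAlg.{u}} (harch : ∀ A ∈ 𝒜, A.IsWeaklyArchimedean)
    (hcontr : ∀ n : ℕ, ∃ A ∈ 𝒜, ¬ A.IsContractive n) {C : Set KripkeModel.{u, v}}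
    (hC₁ : finTransModels 𝒜 ⊆ C) (hC₂ : C ⊆ transModels 𝒜) {prog : ℕ → Instr} {m l : ℕ}
    (hm : ∀ i, (prog i).Within m i) (hl : l < m) (n : ℕ) :
    (∃ M ∈ C, Nontrivial M.alg ∧ ∃ w : M.World, M.Sat w (reaches prog m l n)) ↔
      ∃ t, (Cfg.run prog n t).pc = l := by
  constructor
  · rintro ⟨M, hM, hnt, w, hw⟩
    obtain ⟨⟨hA, hsafe⟩, htrans⟩ := hC₂ hM
    exact exists_run_of_sat hsafe htrans (harch _ hA) hm hl hw
  · rintro ⟨t, rfl⟩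
    obtain ⟨M, hM, h⟩ := exists_model_of_run harch hcontr hm
    exact ⟨M, hC₁ hM, h⟩

open KripkeModel Formula in
theorem not_computablePred_valid {𝒜 : Set FLewAlg.{u}} (harch : ∀ A ∈ 𝒜, A.IsWeaklyArchimedean)
    (hcontr : ∀ n : ℕ, ∃ A ∈ 𝒜, ¬ A.IsContractive n) {C : Set KripkeModel.{u, v}}
    (hC₁ : finTransModels 𝒜 ⊆ C) (hC₂ : C ⊆ transModels 𝒜) :
    ¬ ComputablePred fun φ : Formula => Valid C φ := by
  intro h
  obtain ⟨p, hp⟩ := exists_undecidable_prog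
  obtain ⟨m, hpm, hm⟩ := p.exists_within_machine
  refine hp ((ComputablePred.computable_of_manyOneReducible
    (p := fun n => ¬ ∃ t, (Cfg.run p.machine n t).pc = p.size)
    ⟨fun n => crispNot (reaches p.machine m p.size n),
      (primrec_crispNot.comp (primrec_reaches _ _ _)).to_comp, fun n => ?_⟩ h).not.of_eq
    fun n => not_not)
  refine (exists_sat_reaches_iff harch hcontr hC₁ hC₂ hm hpm n).not.symm.trans ?_
  constructor
  · intro hno M hM w _
    -- over a trivial algebra every formula is valid
    rcases subsingleton_or_nontrivial M.alg with hs | hnt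
    · exact Subsingleton.elim _ _
    · exact sat_crispNot.2 fun hw => hno ⟨M, hM, hnt, w, hw⟩
  · rintro hval ⟨M, hM, hnt, w, hw⟩
    exact sat_crispNot.1 (hval M hM w (by simp)) hw

open Formula in
theorem not_computablePred_locallySatisfiable {𝒜 : Set FLewAlg.{u}}
    (harch : ∀ A ∈ 𝒜, A.IsWeaklyArchimedean)
    (hcontr : ∀ n : ℕ, ∃ A ∈ 𝒜, ¬ A.IsContractive n) (hnt : ∀ A ∈ 𝒜, Nontrivial A)
    {C : Set KripkeModel.{u, v}} (hC₁ : finTransModels 𝒜 ⊆ C) (hC₂ : C ⊆ transModels 𝒜) :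
    ¬ ComputablePred fun φ : Formula => LocallySatisfiable C φ := by
  intro h
  obtain ⟨p, hp⟩ := exists_undecidable_prog
  obtain ⟨m, hpm, hm⟩ := p.exists_within_machine
  refine hp (ComputablePred.computable_of_manyOneReducible
    ⟨reaches p.machine m p.size, (primrec_reaches _ _ _).to_comp, fun n => ?_⟩ h)
  refine (exists_sat_reaches_iff harch hcontr hC₁ hC₂ hm hpm n).symm.trans ?_
  constructor
  · rintro ⟨M, hM, -, hw⟩
    exact ⟨M, hM, hw⟩
  · rintro ⟨M, hM, hw⟩
    exact ⟨M, hM, hnt _ (hC₂ hM).1.1, hw⟩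

end ModalFLew

theorem mainTheorem7 (𝒜 : Set ModalFLew.FLewAlg.{u})
    (hchain : ∀ A ∈ 𝒜, A.IsChain)
    (harch : ∀ A ∈ 𝒜, A.IsWeaklyArchimedean)
    (hcontr : ∀ n : ℕ, ∃ A ∈ 𝒜, ¬ A.IsContractive n) :
    (¬ ComputablePred (fun φ : ModalFLew.Formula =>
        ModalFLew.Valid (ModalFLew.transModels.{u, v} 𝒜) φ) ∧
      ¬ ComputablePred (fun φ : ModalFLew.Formula =>
        ModalFLew.Valid (ModalFLew.finTransModels.{u, v} 𝒜) φ)) ∧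
    ((∀ A ∈ 𝒜, Nontrivial A) →
      ¬ ComputablePred (fun φ : ModalFLew.Formula =>
        ModalFLew.LocallySatisfiable (ModalFLew.transModels.{u, v} 𝒜) φ) ∧
      ¬ ComputablePred (fun φ : ModalFLew.Formula =>
        ModalFLew.LocallySatisfiable (ModalFLew.finTransModels.{u, v} 𝒜) φ)) := by
  have hsub : ModalFLew.finTransModels.{u, v} 𝒜 ⊆ ModalFLew.transModels 𝒜 := fun _ h => h.1
  exact ⟨⟨ModalFLew.not_computablePred_valid harch hcontr hsub subset_rfl,
      ModalFLew.not_computablePred_valid harch hcontr subset_rfl hsub⟩,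
    fun hnt =>
      ⟨ModalFLew.not_computablePred_locallySatisfiable harch hcontr hnt hsub subset_rfl,
        ModalFLew.not_computablePred_locallySatisfiable harch hcontr hnt subset_rfl hsub⟩⟩
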